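/- Let $S\subseteq\mathbb N^q$ be an affine semigroup (a finitely generated submonoid of $\mathbb N^q$) with minimal generating set $\{a_1,\dots,a_h\}$, and let $\mathbb K$ be a field. For $n\in\mathbb N^q$ let $\mathrm Z_n(S)=\{\lambda\in\mathbb N^h : \sum_{i=1}^h\lambda_i a_i=n\}$ be the set of factorizations of $n$. The semigroup ideal of $S$ is $$I_S=\Big\langle x^\alpha-x^\beta \ :\ \alpha,\beta\in\mathbb N^h,\ \sum_{i=1}^h\alpha_i a_i=\sum_{i=1}^h\beta_i a_i\Big\rangle\subseteq\mathbb K[x_1,\dots,x_h].$$ A binomial is a polynomial with exactly two terms; a binomial $f\in I_S$ is called indispensable if every generating set of $I_S$ that consists of binomials contains a nonzero scalar multiple of $f$. Let $\mathcal C(S)=\{\sum_{i=1}^h\lambda_i a_i : \lambda_i\in\mathbb Q_{\ge 0}\}\cap\mathbb N^q$. For $p\ge 1$ and a graded monomial order $\preceq$ on $\mathbb N^q$ (one that compares total degrees first), let $F_p(S)$ be the maximum with respect to $\preceq$ of $\{n\in\mathcal C(S) : 0<\#\mathrm Z_n(S)\le p\}$ if this set is finite, and $F_p(S)=(\infty,\dots,\infty)$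 otherwise. (1) If some $m\in S$ has exactly two factorizations, i.e. $\#\mathrm Z_m(S)=2$, then $I_S$ contains an indispensable binomial. (2) If $I_S$ contains no indispensable binomial, then $F_1(S)=F_2(S)$ for every graded monomial order $\preceq$ on $\mathbb N^q$. If, in addition, for every $k\in\{1,\dots,h\}$ some positive integer multiple of $a_k$ is a linear combination of the other generators $a_i$ $(i\ne k)$ with coefficients in $\mathbb N$, then this common value is finite, that is, a vector of $\mathbb N^q$. -/

import Mathlib

open scoped MonomialOrder

namespace AffineSemigroup

variable {q h : ℕ}

/-- The family `a₁, …, a_h` of vectors of `ℕ^q` lists, without repetition, the elements of an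
inclusion-minimal generating set of the affine semigroup `S ⊆ ℕ^q`. -/
def IsMinimalGenerating (a : Fin h → (Fin q →₀ ℕ)) (S : AddSubmonoid (Fin q →₀ ℕ)) : Prop :=
  Function.Injective a ∧
    Minimal (fun A : Set (Fin q →₀ ℕ) => AddSubmonoid.closure A = S) (Set.range a)

/-- `Z_n(S)`: the set of factorizations `(l₁, …, l_h)` of `n`, that is, `n = ∑ l_i a_i`. -/
def factorizations (a : Fin h → (Fin q →₀ ℕ)) (n : Fin q →₀ ℕ) : Set (Fin h →₀ ℕ) :=
  {l | ∑ i, l i • a i = n}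

/-- The integer cone `C(S)`: the vectors of `ℕ^q` that are combinations of the generators with
nonnegative rational coefficients. -/
def integerCone (a : Fin h → (Fin q →₀ ℕ)) : Set (Fin q →₀ ℕ) :=
  {n | ∃ c : Fin h → ℚ, (∀ i, 0 ≤ c i) ∧ ∀ j, (n j : ℚ) = ∑ i, c i * (a i j : ℚ)}

/-- A monomial order is graded if it compares total degrees first. -/
def IsGraded (ord : MonomialOrder (Fin q)) : Prop :=
  ∀ u v : Fin q →₀ ℕ, u.degree < v.degree → u ≺[ord] v

/-- For `p ≥ 1`, the set `{n ∈ C(S) | 0 < #Z_n(S) ≤ p}`. -/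
def frobeniusSet (a : Fin h → (Fin q →₀ ℕ)) (p : ℕ) : Set (Fin q →₀ ℕ) :=
  {n | n ∈ integerCone a ∧ 0 < (factorizations a n).encard ∧ (factorizations a n).encard ≤ p}

open Classical in
/-- For `p ≥ 1`, the `p`-Frobenius vector `F_p(S)`: the maximum of `frobeniusSet a p` for the
monomial order `ord` if that set is finite, and infinity (the vector `(∞, …, ∞)`, represented
by `⊤`) otherwise. For a minimal generating family and `p ≥ 1` the set contains `0`, so it is
never empty. -/
noncomputable def frobeniusVector (ord : MonomialOrder (Fin q)) (a : Fin h → (Fin q →₀ ℕ))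
    (p : ℕ) : WithTop (Fin q →₀ ℕ) :=
  if hfin : (frobeniusSet a p).Finite then
    ((ord.toSyn.symm (hfin.toFinset.sup ord.toSyn) : Fin q →₀ ℕ) : WithTop (Fin q →₀ ℕ))
  else ⊤

/-- Every generator has a positive multiple that is a nonnegative integer combination of the
other generators. -/
def MultiplesOfOthers (a : Fin h → (Fin q →₀ ℕ)) : Prop :=
  ∀ k, ∃ l : ℕ, 0 < l ∧ ∃ c : Fin h → ℕ, l • a k = ∑ i ∈ Finset.univ.erase k, c i • a i

/-- The semigroup ideal `I_S` of `K[x₁, …, x_h]`. -/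
noncomputable def semigroupIdeal (K : Type*) [Field K] (a : Fin h → (Fin q →₀ ℕ)) :
    Ideal (MvPolynomial (Fin h) K) :=
  Ideal.span {f | ∃ u v : Fin h →₀ ℕ, ∑ i, u i • a i = ∑ i, v i • a i ∧
    f = MvPolynomial.monomial u 1 - MvPolynomial.monomial v 1}

/-- A binomial: a polynomial with exactly two terms. -/
def IsBinomial {K : Type*} [Field K] (f : MvPolynomial (Fin h) K) : Prop :=
  ∃ (u v : Fin h →₀ ℕ) (c d : K), u ≠ v ∧ c ≠ 0 ∧ d ≠ 0 ∧
    f = MvPolynomial.monomial u c + MvPolynomial.monomial v d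

/-- An indispensable binomial of the ideal `I`: a binomial of `I` that occurs, up to a nonzero
scalar multiple, in every generating set of `I` consisting of binomials. -/
def IsIndispensable {K : Type*} [Field K] (I : Ideal (MvPolynomial (Fin h) K))
    (f : MvPolynomial (Fin h) K) : Prop :=
  IsBinomial f ∧ f ∈ I ∧
    ∀ G : Set (MvPolynomial (Fin h) K), (∀ g ∈ G, IsBinomial g) → Ideal.span G = I →
      ∃ c : K, c ≠ 0 ∧ c • f ∈ G

end AffineSemigroup

namespace AffineSemigroup

variable {q h : ℕ} {K : Type*} [Field K]

/-! If `m` has exactly two factorizations `u`, `v`, cancelling `u ⊓ v` leaves disjoint `u'`, `v'`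
that are the only factorizations of their common degree. A binomial of the ideal with a term
dividing `x^u'` is then a scalar multiple of `x^u' - x^v'` (`eq_smul_of_le`). A binomial generating
set without such a multiple would only produce polynomials with zero coefficient at `x^u'`, so `x^u'
- x^v'` is indispensable (`isIndispensable_of_disjoint`).

Hence, without indispensable binomials, no degree has exactly two factorizations, and the sets
defining `F_1` and `F_2` coincide. For finiteness, a unique factorization cannot contain `l k`
copies of `a k` when `l k • a k` can be rewritten with the other generators, so unique
factorizations lie in a finite box. -/

theorem mem_factorizations {a : Fin h → (Fin q →₀ ℕ)} {n : Fin q →₀ ℕ} {l : Fin h →₀ ℕ} :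
    l ∈ factorizations a n ↔ ∑ i, l i • a i = n := Iff.rfl

theorem sum_add_smul (a : Fin h → (Fin q →₀ ℕ)) (u v : Fin h →₀ ℕ) :
    ∑ i, (u + v) i • a i = ∑ i, u i • a i + ∑ i, v i • a i := by
  simp [add_smul, Finset.sum_add_distrib]

/-- The homomorphism `x_i ↦ t^{a_i}`, whose kernel contains the semigroup ideal. -/
noncomputable def toricHom (K : Type*) [Field K] (a : Fin h → (Fin q →₀ ℕ)) :
    MvPolynomial (Fin h) K →ₐ[K] MvPolynomial (Fin q) K :=
  MvPolynomial.aeval fun i => MvPolynomial.monomial (a i) 1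

theorem toricHom_monomial (a : Fin h → (Fin q →₀ ℕ)) (u : Fin h →₀ ℕ) (c : K) :
    toricHom K a (MvPolynomial.monomial u c) = MvPolynomial.monomial (∑ i, u i • a i) c := by
  rw [toricHom, MvPolynomial.aeval_monomial, Finsupp.prod_fintype _ _ (by simp)]
  simp only [MvPolynomial.monomial_pow, one_pow]
  rw [← MvPolynomial.monomial_sum_one, MvPolynomial.algebraMap_eq, MvPolynomial.C_mul_monomial,
    mul_one]

theorem toricHom_eq_zero_of_mem {a : Fin h → (Fin q →₀ ℕ)} {f : MvPolynomial (Fin h) K}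
    (hf : f ∈ semigroupIdeal K a) : toricHom K a f = 0 := by
  have hle : semigroupIdeal K a ≤ RingHom.ker (toricHom K a) := by
    refine Ideal.span_le.2 ?_
    rintro _ ⟨u, v, huv, rfl⟩
    simp [RingHom.mem_ker, toricHom_monomial, huv]
  exact hle hf

/-- The two terms of a binomial of the semigroup ideal have the same degree and opposite
coefficients. -/
theorem eq_and_add_eq_zero_of_mem {a : Fin h → (Fin q →₀ ℕ)} {u v : Fin h →₀ ℕ} {c d : K}
    (hc : c ≠ 0)
    (hf : MvPolynomial.monomial u c + MvPolynomial.monomial v d ∈ semigroupIdeal K a) :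
    ∑ i, u i • a i = ∑ i, v i • a i ∧ c + d = 0 := by
  have h0 := toricHom_eq_zero_of_mem hf
  rw [map_add, toricHom_monomial, toricHom_monomial] at h0
  -- If the two degrees differed, the coefficient here would be `c`, which is nonzero.
  have h1 := congrArg (MvPolynomial.coeff (∑ i, u i • a i)) h0
  rw [MvPolynomial.coeff_add, MvPolynomial.coeff_monomial, MvPolynomial.coeff_monomial,
    if_pos rfl, MvPolynomial.coeff_zero] at h1
  split_ifs at h1 with huv
  · exact ⟨huv.symm, h1⟩
  · exact absurd (by simpa using h1) hc

/-- If `u`, `v` are disjoint and are the only factorizations of their degree, then a binomial of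
the semigroup ideal one of whose terms divides `x^u` is a multiple of `x^u - x^v`. -/
theorem eq_smul_of_le {a : Fin h → (Fin q →₀ ℕ)} {n : Fin q →₀ ℕ} {u v : Fin h →₀ ℕ}
    (hZ : factorizations a n = {u, v}) (hdisj : u ⊓ v = 0) {s t : Fin h →₀ ℕ} {c d : K}
    (hst : s ≠ t) (hc : c ≠ 0)
    (hg : MvPolynomial.monomial s c + MvPolynomial.monomial t d ∈ semigroupIdeal K a)
    (hs : s ≤ u) :
    MvPolynomial.monomial s c + MvPolynomial.monomial t d =
      c • (MvPolynomial.monomial u 1 - MvPolynomial.monomial v 1 : MvPolynomial (Fin h) K) := by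
  obtain ⟨hdeg, hcd⟩ := eq_and_add_eq_zero_of_mem hc hg
  obtain ⟨e, rfl⟩ := exists_add_of_le hs
  have hu : ∑ i, (s + e) i • a i = n := by
    rw [← mem_factorizations, hZ]; exact Set.mem_insert _ _
  have ht : t + e ∈ factorizations a n := by
    rw [mem_factorizations, sum_add_smul, ← hdeg, ← sum_add_smul, hu]
  rw [hZ] at ht
  rcases ht with ht | ht
  -- Here both terms complete to `x^u` with the same cofactor `e`, which forces `s = t`.
  · exact absurd (add_right_cancel ht).symm hst
  · have ht : t + e = v := ht
    subst ht
    -- The cofactor `e` lies below both of the disjoint vectors.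
    have he : e = 0 := by
      have : e ≤ (s + e) ⊓ (t + e) := le_inf le_add_self le_add_self
      rw [hdisj] at this
      exact le_antisymm this (zero_le)
    subst he
    rw [eq_neg_of_add_eq_zero_right hcd]
    simp [MvPolynomial.smul_monomial, sub_eq_add_neg]

/-- Quantifying over all multipliers `p` makes the vanishing condition stable under multiplication
by ring elements, which the induction on the span needs. -/
theorem coeff_mul_eq_zero_of_mem_span {G : Set (MvPolynomial (Fin h) K)} {u : Fin h →₀ ℕ}
    (hG : ∀ g ∈ G, ∀ p, MvPolynomial.coeff u (p * g) = 0) {f : MvPolynomial (Fin h) K}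
    (hf : f ∈ Ideal.span G) : ∀ p, MvPolynomial.coeff u (p * f) = 0 := by
  induction hf using Submodule.span_induction with
  | mem g hg => exact hG g hg
  | zero => simp
  | add x y _ _ hx hy => intro p; rw [mul_add, MvPolynomial.coeff_add, hx, hy, add_zero]
  | smul r x _ hx => intro p; rw [smul_eq_mul, ← mul_assoc, hx]

/-- Two disjoint vectors that are the only factorizations of their degree give an indispensable
binomial. -/
theorem isIndispensable_of_disjoint {a : Fin h → (Fin q →₀ ℕ)} {n : Fin q →₀ ℕ}
    {u v : Fin h →₀ ℕ} (hZ : factorizations a n = {u, v}) (huv : u ≠ v) (hdisj : u ⊓ v = 0) :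
    IsIndispensable (semigroupIdeal K a)
      (MvPolynomial.monomial u 1 - MvPolynomial.monomial v 1) := by
  have hu : u ∈ factorizations a n := hZ ▸ Set.mem_insert _ _
  have hv : v ∈ factorizations a n := hZ ▸ Set.mem_insert_of_mem _ rfl
  have hf : (MvPolynomial.monomial u 1 - MvPolynomial.monomial v 1 : MvPolynomial (Fin h) K) ∈
      semigroupIdeal K a :=
    Ideal.subset_span ⟨u, v, (mem_factorizations.1 hu).trans (mem_factorizations.1 hv).symm, rfl⟩
  refine ⟨⟨u, v, 1, -1, huv, one_ne_zero, neg_ne_zero.2 one_ne_zero, by simp [sub_eq_add_neg]⟩,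
    hf, fun G hG hspan => ?_⟩
  by_contra hnot
  have hzero : ∀ g ∈ G, ∀ p, MvPolynomial.coeff u (p * g) = 0 := by
    intro g hg p
    have hgI : g ∈ semigroupIdeal K a := hspan ▸ Ideal.subset_span hg
    obtain ⟨s, t, c, d, hst, hc, hd, rfl⟩ := hG g hg
    have hs : ¬ s ≤ u := fun hs => hnot ⟨c, hc, eq_smul_of_le hZ hdisj hst hc hgI hs ▸ hg⟩
    have ht : ¬ t ≤ u := fun ht => by
      rw [add_comm] at hgI hg
      exact hnot ⟨d, hd, eq_smul_of_le hZ hdisj hst.symm hd hgI ht ▸ hg⟩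
    -- A term of `g` contributes to `x^u` in a product only if it divides `x^u`.
    rw [mul_add, MvPolynomial.coeff_add, MvPolynomial.coeff_mul_monomial',
      MvPolynomial.coeff_mul_monomial', if_neg hs, if_neg ht, add_zero]
  have h1 := coeff_mul_eq_zero_of_mem_span hzero (hspan ▸ hf) 1
  rw [one_mul, MvPolynomial.coeff_sub, MvPolynomial.coeff_monomial, MvPolynomial.coeff_monomial,
    if_pos rfl, if_neg huv.symm, sub_zero] at h1
  exact one_ne_zero h1

theorem exists_isIndispensable {a : Fin h → (Fin q →₀ ℕ)} {m : Fin q →₀ ℕ}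
    (hm : (factorizations a m).encard = 2) :
    ∃ f : MvPolynomial (Fin h) K, IsIndispensable (semigroupIdeal K a) f := by
  obtain ⟨u, v, huv, hZ⟩ := Set.encard_eq_two.1 hm
  obtain ⟨u', hu'⟩ := exists_add_of_le (inf_le_left : u ⊓ v ≤ u)
  obtain ⟨v', hv'⟩ := exists_add_of_le (inf_le_right : u ⊓ v ≤ v)
  have hne : u' ≠ v' := by
    rintro rfl
    exact huv (hu'.trans hv'.symm)
  have hdisj : u' ⊓ v' = 0 := by
    ext i
    have h1 := DFunLike.congr_fun hu' i
    have h2 := DFunLike.congr_fun hv' i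
    simp only [Finsupp.add_apply, Finsupp.inf_apply, Finsupp.coe_zero, Pi.zero_apply] at h1 h2 ⊢
    omega
  refine ⟨_, isIndispensable_of_disjoint (n := ∑ i, u' i • a i) ?_ hne hdisj⟩
  have hum : ∑ i, u i • a i = m := by
    rw [← mem_factorizations, hZ]; exact Set.mem_insert _ _
  have hvm : ∑ i, v i • a i = m := by
    rw [← mem_factorizations, hZ]; exact Set.mem_insert_of_mem _ rfl
  ext l
  constructor
  · intro hl
    -- Adding the common part `u ⊓ v` maps factorizations of the reduced degree injectively into
    -- those of `m`.
    have hl' : u ⊓ v + l ∈ factorizations a m := by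
      rw [mem_factorizations, sum_add_smul, mem_factorizations.1 hl, ← sum_add_smul, ← hu', hum]
    rw [hZ] at hl'
    rcases hl' with hl' | hl'
    · exact Or.inl (add_left_cancel (hl'.trans hu'))
    · exact Or.inr (add_left_cancel (Eq.trans hl' hv'))
  · rintro (rfl | rfl)
    · rfl
    · rw [mem_factorizations]
      apply add_left_cancel (a := ∑ i, (u ⊓ v) i • a i)
      rw [← sum_add_smul, ← sum_add_smul, ← hu', ← hv', hum, hvm]

theorem frobeniusSet_one_eq_two {a : Fin h → (Fin q →₀ ℕ)}
    (ha : ∀ m, (factorizations a m).encard ≠ 2) : frobeniusSet a 1 = frobeniusSet a 2 := by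
  ext n
  refine and_congr_right fun _ => and_congr_right fun _ => ⟨fun hn => ?_, fun hn => ?_⟩
  · exact hn.trans (by norm_num)
  · have hlt : (factorizations a n).encard < 1 + 1 := by
      rw [one_add_one_eq_two]
      exact lt_of_le_of_ne (by simpa using hn) (ha n)
    simpa using Order.le_of_lt_add_one hlt

/-- Every element of the set is the degree of a factorization bounded coordinatewise by `l`: beyond
that bound, exchanging `l k` copies of `a k` would give a second factorization. -/
theorem finite_frobeniusSet_one {a : Fin h → (Fin q →₀ ℕ)} (ha : MultiplesOfOthers a) :
    (frobeniusSet a 1).Finite := by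
  choose l hl c hc using ha
  refine ((Set.finite_Iic (Finsupp.equivFunOnFinite.symm l)).image
    fun u : Fin h →₀ ℕ => ∑ i, u i • a i).subset ?_
  rintro n ⟨-, hpos, hle⟩
  obtain ⟨u, hu⟩ := Set.encard_pos.1 hpos
  refine ⟨u, fun k => ?_, hu⟩
  by_contra hk
  have hk : l k < u k := not_le.1 hk
  obtain ⟨w, hw⟩ := exists_add_of_le (show Finsupp.single k (l k) ≤ u by
    rw [Finsupp.single_le_iff]; exact hk.le)
  have hsingle : ∑ i, (Finsupp.single k (l k)) i • a i = l k • a k := by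
    rw [Finset.sum_eq_single k (fun i _ hi => by simp [Finsupp.single_eq_of_ne hi]) (by simp),
      Finsupp.single_eq_same]
  -- The value `c k k` is unconstrained, so it is reset to `0`.
  let e : Fin h →₀ ℕ := Finsupp.equivFunOnFinite.symm (Function.update (c k) k 0)
  have he : ∑ i, e i • a i = l k • a k := by
    rw [hc k, ← Finset.add_sum_erase _ _ (Finset.mem_univ k)]
    have hek : e k = 0 := by simp [e]
    rw [hek, zero_smul, zero_add]
    refine Finset.sum_congr rfl fun i hi => ?_
    simp [e, Function.update_of_ne (Finset.ne_of_mem_erase hi)]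
  have hew : e + w ∈ factorizations a n := by
    rw [mem_factorizations, sum_add_smul, he, ← hsingle, ← sum_add_smul, ← hw]
    exact hu
  have heq : u = e + w := Set.encard_le_one_iff.1 (by simpa using hle) _ _ hu hew
  -- Uniqueness identifies `Finsupp.single k (l k)` with `e`; at coordinate `k` this reads `l k =
  -- 0`.
  have hek := DFunLike.congr_fun (add_right_cancel (hw.symm.trans heq)) k
  simp only [Finsupp.single_eq_same, e, Finsupp.equivFunOnFinite_symm_apply_apply,
    Function.update_self] at hek
  exact (hl k).ne' hek

end AffineSemigroup

theorem mainTheorem7 {q h : ℕ} {K : Type*} [Field K]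
    (S : AddSubmonoid (Fin q →₀ ℕ)) (a : Fin h → (Fin q →₀ ℕ))
    (ha : AffineSemigroup.IsMinimalGenerating a S) :
    ((∃ m ∈ S, (AffineSemigroup.factorizations a m).encard = 2) →
      ∃ f : MvPolynomial (Fin h) K,
        AffineSemigroup.IsIndispensable (AffineSemigroup.semigroupIdeal K a) f) ∧
    ((¬ ∃ f : MvPolynomial (Fin h) K,
        AffineSemigroup.IsIndispensable (AffineSemigroup.semigroupIdeal K a) f) →
      ∀ ord : MonomialOrder (Fin q), AffineSemigroup.IsGraded ord →
        AffineSemigroup.frobeniusVector ord a 1 = AffineSemigroup.frobeniusVector ord a 2 ∧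
        (AffineSemigroup.MultiplesOfOthers a →
          AffineSemigroup.frobeniusVector ord a 1 ≠ ⊤)) := by
  refine ⟨fun ⟨m, _, hm⟩ => AffineSemigroup.exists_isIndispensable hm, fun hnot ord _ => ?_⟩
  refine ⟨?_, fun hmult => ?_⟩
  · have hset := AffineSemigroup.frobeniusSet_one_eq_two (a := a)
      fun m hm => hnot (AffineSemigroup.exists_isIndispensable hm)
    rw [AffineSemigroup.frobeniusVector, AffineSemigroup.frobeniusVector, hset]
  · rw [AffineSemigroup.frobeniusVector, dif_pos (AffineSemigroup.finite_frobeniusSet_one hmult)]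
    exact WithTop.coe_ne_top
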